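/- Let $\mathcal X,\mathcal Y$ be finite sets, let $p_{XY}$ be a probability mass function on $\mathcal X\times\mathcal Y$, and let $(X_1,Y_1),(X_2,Y_2),\dots$ be i.i.d. with law $p_{XY}$. Let $R>0$. All logarithms, entropies and divergences are to base $2$. A rate $R$ encoder (without access to the side-information) is a sequence of maps $\mathcal E_j:\mathcal X^j\to\{0,1\}^{\lfloor jR\rfloor-\lfloor (j-1)R\rfloor}$, $j=1,2,\dots$, where $\mathcal E_j(x_1^j)=b_{\lfloor (j-1)R\rfloor+1}^{\lfloor jR\rfloor}$ are the bits sent between times $j-1$ and $j$. A decoder with delay $\Delta$ is a sequence of maps $\mathcal D_j^{\Delta}:\{0,1\}^{\lfloor (j+\Delta)R\rfloor}\times\mathcal Y^{j+\Delta}\to\mathcal X$, $j=1,2,\dots$, which give the estimates $\widehat X_j(j+\Delta)=\mathcal D_j^\Delta\big(b_1^{\lfloor (j+\Delta)R\rfloor},Y_1^{j+\Delta}\big)$ of $X_j$. A family $(\mathcal E^\Delta,\mathcal D^\Delta)_{\Delta\ge 1}$ of such codes achieves the reliability $E\in\mathbb R$ if for every $\epsilon>0$ there is $K<\infty$ such that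 $$\Pr\big(X_i\ne\widehat X_i(i+\Delta)\big)\le K\,2^{-\Delta(E-\epsilon)}\qquad\text{for all integers } i\ge 1,\ \Delta\ge 1 .$$ Let $E_{si}(R)\in[0,\infty]$ be the supremum of the reliabilities achieved by such families. Theorem. $E_{si}(R)\le E_{si}^u(R)$, where $$E_{si}^u(R)=\min\Big\{\inf_{\substack{q_{XY},\ \alpha\ge 1:\\ H(q_{X|Y})>(1+\alpha)R}}\frac1\alpha D(q_{XY}\|p_{XY}),\ \inf_{\substack{q_{XY},\ 0\le\alpha\le 1:\\ H(q_{X|Y})>(1+\alpha)R}}\Big(\frac{1-\alpha}{\alpha}D(q_X\|p_X)+D(q_{XY}\|p_{XY})\Big)\Big\}.$$ Here $q_{XY}$ runs over the probability mass functions on $\mathcal X\times\mathcal Y$, $H(q_{X|Y})$ is the conditional entropy of the first coordinate given the second under $q_{XY}$, $q_X$ and $p_X$ are the marginals on $\mathcal X$, the infimum of the empty set is $+\infty$, and at $\alpha=0$ the factor $\frac{1-\alpha}{\alpha}$ is read as $+\infty$ with $\infty\cdot 0=0$ (leaving out $\alpha=0$ does not change the infimum). -/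

import Mathlib

open scoped ENNReal

/-! Conventions.  `X` is the finite source alphabet, `Y` the finite side-information alphabet, and
probability mass functions on `X × Y` are elements of `stdSimplex ℝ (X × Y)`.  Time is counted in
source symbols `1, 2, 3, …`; the symbol of time `k + 1` carries the index `k`.  All logarithms are
to base 2, so that rates, entropies and divergences are in bits. -/

namespace DelaySI

noncomputable section

variable {X Y A : Type*}

section Information

/-- The `X`-marginal of `q`. -/
def marginalX [Fintype Y] (q : X × Y → ℝ) (x : X) : ℝ := ∑ y, q (x, y)

/-- The `Y`-marginal of `q`. -/
def marginalY [Fintype X] (q : X × Y → ℝ) (y : Y) : ℝ := ∑ x, q (x, y)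

/-- The conditional entropy `H(q_{X|Y})` in bits, with `0 log 0 = 0`. -/
def condEntropy [Fintype X] [Fintype Y] (q : X × Y → ℝ) : ℝ :=
  -∑ x, ∑ y, q (x, y) * Real.logb 2 (q (x, y) / marginalY q y)

open Classical in
/-- The divergence `D(q‖p)` in bits of two probability mass functions on a finite set; it is `∞`
unless `q` vanishes wherever `p` does. -/
def divergence [Fintype A] (q p : A → ℝ) : ℝ≥0∞ :=
  if ∀ a, p a = 0 → q a = 0 then ENNReal.ofReal (∑ a, q a * Real.logb 2 (q a / p a)) else ∞

end Information

section Codes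

/-- The number of bits sent from time `k` to time `k + 1` at rate `R`. -/
def newBits (R : ℝ) (k : ℕ) : ℕ := ⌊((k : ℝ) + 1) * R⌋₊ - ⌊(k : ℝ) * R⌋₊

/-- The bits sent until time `n`, grouped by the time at which they were sent. Altogether these are
`⌊n R⌋` bits, the groups having the fixed lengths `newBits R k`. -/
abbrev Bits (R : ℝ) (n : ℕ) : Type := (k : Fin n) → Fin (newBits R k) → Bool

/-- A rate `R` encoder without access to the side-information: the bits sent from time `k` to time
`k + 1` are a function of the first `k + 1` source symbols. -/
abbrev Encoder (X : Type*) (R : ℝ) : Type _ :=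
  (k : ℕ) → (Fin (k + 1) → X) → Fin (newBits R k) → Bool

/-- All the bits that the encoder emits until time `n`. -/
def Encoder.sent {R : ℝ} (e : Encoder X R) (n : ℕ) (x : Fin n → X) : Bits R n :=
  fun k => e k fun i => x (Fin.castLE k.isLt i)

/-- A fixed delay `Δ` decoder: the symbol of time `k + 1` is estimated at time `k + 1 + Δ` from all
the bits emitted and all the side-information seen until then. -/
abbrev Decoder (X Y : Type*) (R : ℝ) (Δ : ℕ) : Type _ :=
  (k : ℕ) → Bits R (k + 1 + Δ) → (Fin (k + 1 + Δ) → Y) → X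

open Classical in
/-- The probability, when the pairs of source symbol and side-information are i.i.d. with law `p`,
that the symbol of time `k + 1` is not estimated correctly at time `k + 1 + Δ`. -/
def errorProb [Fintype X] [Fintype Y] (p : X × Y → ℝ) {R : ℝ} {Δ : ℕ}
    (e : Encoder X R) (d : Decoder X Y R Δ) (k : ℕ) : ℝ :=
  ∑ z : Fin (k + 1 + Δ) → X × Y,
    if d k (e.sent (k + 1 + Δ) fun i => (z i).1) (fun i => (z i).2) ≠ (z ⟨k, by omega⟩).1
    then ∏ i, p (z i) else 0

/-- The family of codes `(e Δ, d Δ)` achieves the fixed-delay reliability `E`. -/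
def Achieves [Fintype X] [Fintype Y] (p : X × Y → ℝ) {R : ℝ}
    (e : (Δ : ℕ) → Encoder X R) (d : (Δ : ℕ) → Decoder X Y R Δ) (E : ℝ) : Prop :=
  ∀ ε : ℝ, 0 < ε → ∃ K : ℝ, ∀ k Δ : ℕ, 0 < Δ →
    errorProb p (e Δ) (d Δ) k ≤ K * (2 : ℝ) ^ (-((Δ : ℝ) * (E - ε)))

/-- The fixed-delay error exponent `E_si(R)` with side-information only at the decoder: the
supremum of the reliabilities that are achieved by some family of rate `R` codes. -/
def exponentSI [Fintype X] [Fintype Y] (p : X × Y → ℝ) (R : ℝ) : EReal :=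
  ⨆ (E : ℝ) (_ : ∃ (e : (Δ : ℕ) → Encoder X R) (d : (Δ : ℕ) → Decoder X Y R Δ),
    Achieves p e d E), (E : EReal)

end Codes

section Bound

/-- The infimum over `q_{XY}` and `α ≥ 1`. -/
def boundLarge [Fintype X] [Fintype Y] (p : X × Y → ℝ) (R : ℝ) : ℝ≥0∞ :=
  ⨅ (q : X × Y → ℝ) (α : ℝ) (_ : q ∈ stdSimplex ℝ (X × Y)) (_ : 1 ≤ α)
    (_ : (1 + α) * R < condEntropy q),
    1 / ENNReal.ofReal α * divergence q p

/-- The infimum over `q_{XY}` and `0 ≤ α ≤ 1`. At `α = 0` the arithmetic of `[0, ∞]` gives the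
factor `(1 - α) / α` the value `∞`, with `∞ * 0 = 0`. -/
def boundSmall [Fintype X] [Fintype Y] (p : X × Y → ℝ) (R : ℝ) : ℝ≥0∞ :=
  ⨅ (q : X × Y → ℝ) (α : ℝ) (_ : q ∈ stdSimplex ℝ (X × Y)) (_ : 0 ≤ α) (_ : α ≤ 1)
    (_ : (1 + α) * R < condEntropy q),
    ENNReal.ofReal (1 - α) / ENNReal.ofReal α * divergence (marginalX q) (marginalX p)
      + divergence q p

/-- The upper bound `E_si^u(R)`. -/
def upperBoundSI [Fintype X] [Fintype Y] (p : X × Y → ℝ) (R : ℝ) : ℝ≥0∞ :=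
  min (boundLarge p R) (boundSmall p R)

end Bound

end

end DelaySI

/-! Let `q` be a law with `(1 + α) R < H(q_{X|Y})`, let `n = ⌈Δ / α⌉`, and suppose that the first
`n` pairs have law `q` instead of `p`. Until time `n + Δ`, when the last of these symbols is
decoded, at most `(n + Δ) R ≤ n (1 + α) R` bits are sent, too few to describe `n` symbols given
their side-information. Hence some decoder is likely to err, and a change of measure back to `p`
bounds its error probability from below.

Changing the measure of all pairs costs the exponent `n D(q‖p)`, which is what the bound for `α ≥
1` asks for. For `α ≤ 1` the cost is lowered by giving the decoder of symbol `k + 1` the true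
symbols before the cut `m = min k (n - Δ)`. Given these symbols the side-information of the same
times is useless, so it can be replaced by a function of them (`exists_past_sideInfo`).
Afterwards only the `X`-marginal has to be changed before the cut, at the cost `D(q_X‖p_X)` per
symbol, and at most `Δ + 1` later pairs which this decoder sees are to be changed in full. The
decoders with the cuts still work in succession: if all are correct, the bits, the
side-information and the symbols after time `n` determine everything (`eq_of_sent_eq`).

No typical sets or entropy inequalities are needed. Both the counting of the correctly decoded
sequences and the change of measure rest on the elementary inequality `∏ w ≤ ∏ w exp (-l) + ∏ w
exp (s l)` (`prod_le_prod_tilt`) with `l` a log-likelihood ratio shifted so as to have negative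
mean; for small `s > 0` the last term then sums to something exponentially small
(`eventually_sum_mul_exp_lt_one`). The result is the finite-delay inequality `one_le_of_tilt`. If
a reliability exceeded the bound, its right side would tend to `0` with growing delay
(`Achieves.le_of_tilt`). -/

namespace DelaySI

open Finset Filter Topology

/-! ### Exponential tilting of product weights -/

/-- If `l` has negative mean under the weights `w`, then its moment generating function is below
`1` at all small positive arguments. -/
theorem eventually_sum_mul_exp_lt_one {A : Type*} [Fintype A] {w l : A → ℝ}
    (hw : ∑ a, w a = 1) (hl : ∑ a, w a * l a < 0) :
    ∀ᶠ s in 𝓝[>] (0 : ℝ), ∑ a, w a * Real.exp (s * l a) < 1 := by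
  have hd : HasDerivAt (fun s : ℝ => ∑ a, w a * Real.exp (s * l a)) (∑ a, w a * l a) 0 := by
    have := HasDerivAt.fun_sum (u := (univ : Finset A)) fun a _ =>
      (((hasDerivAt_id (0 : ℝ)).mul_const (l a)).exp.const_mul (w a))
    simpa using this
  have ht := (hasDerivAt_iff_tendsto_slope.1 hd).mono_left (nhdsGT_le_nhdsNE 0)
  filter_upwards [ht.eventually_lt_const hl, self_mem_nhdsWithin] with s hs hs0
  have hs0 : 0 < s := hs0
  rw [slope_def_field] at hs
  simp only [zero_mul, Real.exp_zero, mul_one, hw, sub_zero] at hs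
  rw [div_lt_iff₀ hs0] at hs
  linarith

/-- Splitting according to the sign of `∑ i, l i`: the first summand dominates if it is nonpositive,
the second one if it is nonnegative. -/
theorem prod_le_prod_tilt {ι : Type*} [Fintype ι] {w l : ι → ℝ} (hw : ∀ i, 0 ≤ w i) {s : ℝ}
    (hs : 0 ≤ s) :
    ∏ i, w i ≤ ∏ i, w i * Real.exp (-l i) + ∏ i, w i * Real.exp (s * l i) := by
  have h0 : 0 ≤ ∏ i, w i := prod_nonneg fun i _ => hw i
  rw [prod_mul_distrib, prod_mul_distrib, ← Real.exp_sum, ← Real.exp_sum, ← mul_sum,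
    sum_neg_distrib]
  rcases le_total (∑ i, l i) 0 with h | h
  · have h1 : 1 ≤ Real.exp (-∑ i, l i) := Real.one_le_exp (by linarith)
    have h2 := mul_nonneg h0 (Real.exp_pos (s * ∑ i, l i)).le
    nlinarith
  · have h1 : 1 ≤ Real.exp (s * ∑ i, l i) := Real.one_le_exp (mul_nonneg hs h)
    have h2 := mul_nonneg h0 (Real.exp_pos (-∑ i, l i)).le
    nlinarith

/-- Change of measure for a test function `F` with values in `[0, 1]`: passing from the weights `w`
to the weights `w * exp (-l)` costs no more than a product of moment generating functions. -/
theorem sum_prod_mul_le_tilt {ι A : Type*} [Fintype ι] [DecidableEq ι] [Fintype A]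
    {w l : ι → A → ℝ} (hw : ∀ i a, 0 ≤ w i a) {s : ℝ} (hs : 0 ≤ s) {F : (ι → A) → ℝ}
    (hF0 : ∀ z, 0 ≤ F z) (hF1 : ∀ z, F z ≤ 1) :
    ∑ z, (∏ i, w i (z i)) * F z ≤
      ∑ z, (∏ i, w i (z i) * Real.exp (-l i (z i))) * F z +
        ∏ i, ∑ a, w i a * Real.exp (s * l i a) := by
  rw [Fintype.prod_sum, ← sum_add_distrib]
  refine sum_le_sum fun z _ => ?_
  have h := mul_le_mul_of_nonneg_right
    (prod_le_prod_tilt (w := fun i => w i (z i)) (l := fun i => l i (z i)) (fun i => hw i (z i)) hs)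
    (hF0 z)
  have h2 : 0 ≤ ∏ i, w i (z i) * Real.exp (s * l i (z i)) :=
    prod_nonneg fun i _ => mul_nonneg (hw _ _) (Real.exp_pos _).le
  rw [add_mul] at h
  exact h.trans (by gcongr; exact mul_le_of_le_one_right h2 (hF1 z))

/-! ### Sums over product spaces -/

/-- Coordinates that a function does not depend on may be summed out. -/
theorem sum_prod_mul_castLE {A : Type*} [Fintype A] {w : ℕ → A → ℝ} (hw : ∀ i, ∑ a, w i a = 1)
    {M N : ℕ} (h : M ≤ N) (F : (Fin M → A) → ℝ) :
    ∑ z : Fin N → A, (∏ i : Fin N, w i (z i)) * F (fun i => z (Fin.castLE h i)) =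
      ∑ z : Fin M → A, (∏ i : Fin M, w i (z i)) * F z := by
  obtain ⟨r, rfl⟩ := Nat.exists_eq_add_of_le h
  rw [← (Fin.appendEquiv M r).sum_comp, Fintype.sum_prod_type]
  refine sum_congr rfl fun u _ => ?_
  have h1 : ∀ v : Fin r → A,
      (fun i => Fin.appendEquiv M r (u, v) (Fin.castLE h i)) = u := fun v => by
    ext i
    exact Fin.append_left u v i
  simp only [h1, Fin.prod_univ_add]
  simp only [Fin.appendEquiv, Equiv.coe_fn_mk, Fin.append_left, Fin.append_right, Fin.val_castAdd,
    Fin.val_natAdd]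
  rw [← sum_mul, ← mul_sum,
    ← Fintype.prod_sum (fun (i : Fin r) (a : A) => w (M + i) a)]
  simp [hw]

/-- If the points of `C` are determined by their image in `B` together with the values `π i (z i)`,
and the weights `v i` are dominated by weights of these values, then `C` has at most `card B` times
the mass of the product of the dominating weights. -/
theorem sum_prod_le_card_mul {ι A B D : Type*} [Fintype ι] [DecidableEq ι] [Fintype B] [Fintype D]
    {C : Finset (ι → A)} {β : (ι → A) → B} {π : ι → A → D}
    (hC : Set.InjOn (fun z => (β z, fun i => π i (z i))) (C : Set (ι → A)))
    {v : ι → A → ℝ} {V : ι → D → ℝ} (hv : ∀ i a, 0 ≤ v i a) (hV : ∀ i t, 0 ≤ V i t)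
    (hvV : ∀ i a, v i a ≤ V i (π i a)) :
    ∑ z ∈ C, ∏ i, v i (z i) ≤ Fintype.card B * ∏ i, ∑ t, V i t := by
  classical
  calc ∑ z ∈ C, ∏ i, v i (z i)
      ≤ ∑ z ∈ C, ∏ i, V i (π i (z i)) :=
        sum_le_sum fun z _ => prod_le_prod (fun i _ => hv _ _) fun i _ => hvV _ _
    _ = ∑ b ∈ C.image (fun z => (β z, fun i => π i (z i))), ∏ i, V i (b.2 i) :=
        (sum_image (f := fun b : B × (ι → D) => ∏ i, V i (b.2 i)) hC).symm
    _ ≤ ∑ b : B × (ι → D), ∏ i, V i (b.2 i) :=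
        sum_le_univ_sum_of_nonneg fun b => prod_nonneg fun i _ => hV _ _
    _ = Fintype.card B * ∏ i, ∑ t, V i t := by
        rw [Fintype.sum_prod_type, Fintype.prod_sum]
        simp

/-- Separating the coordinates before `m` from the others. -/
theorem sum_pi_eq_sum_sum_subtype {A : Type*} [Fintype A] {M : ℕ} (m : ℕ)
    (f : (Fin M → A) → ℝ) :
    ∑ z, f z = ∑ u : {i : Fin M // (i : ℕ) < m} → A, ∑ v : {i : Fin M // ¬(i : ℕ) < m} → A,
      f fun i => if h : (i : ℕ) < m then u ⟨i, h⟩ else v ⟨i, h⟩ := by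
  rw [← (Equiv.piEquivPiSubtypeProd (fun i : Fin M => (i : ℕ) < m) fun _ => A).symm.sum_comp,
    Fintype.sum_prod_type]
  rfl

theorem sum_pi_prod_eq_sum_sum {ι X Y : Type*} [Fintype ι] [DecidableEq ι] [Fintype X] [Fintype Y]
    (f : (ι → X × Y) → ℝ) :
    ∑ z, f z = ∑ x : ι → X, ∑ y : ι → Y, f fun i => (x i, y i) := by
  rw [← (Equiv.arrowProdEquivProdArrow ι (fun _ => X) fun _ => Y).symm.sum_comp,
    Fintype.sum_prod_type]
  rfl

/-! ### Fixing the past side-information -/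

/-- Once the symbols before `m` are known, the side-information before `m` may be replaced by a
function `ψ` of these symbols without increasing the mean of `F`: take the value which is best on
average over the coordinates from `m` on. After the replacement, only the `X`-marginals of the
weights before `m` matter. -/
theorem exists_past_sideInfo {X Y : Type*} [Fintype X] [Fintype Y] [Nonempty Y] {M : ℕ} (m : ℕ)
    {P : Fin M → X × Y → ℝ} (hP : ∀ i a, 0 ≤ P i a)
    {F : (Fin M → X) → (Fin M → Y) → ℝ} (hF : ∀ x y, 0 ≤ F x y) :
    ∃ ψ : (Fin M → X) → Fin M → Y,
      (∀ x x' : Fin M → X, (∀ i : Fin M, (i : ℕ) < m → x i = x' i) → ψ x = ψ x') ∧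
      ∀ S : Fin M → X × Y → ℝ, (∀ i a, 0 ≤ S i a) →
        (∀ i : Fin M, (i : ℕ) < m → ∀ x, ∑ y, S i (x, y) ≤ ∑ y, P i (x, y)) →
        (∀ i : Fin M, m ≤ i → ∀ a, S i a ≤ P i a) →
        ∑ z : Fin M → X × Y, (∏ i, S i (z i)) *
            F (fun i => (z i).1)
              (fun i => if (i : ℕ) < m then ψ (fun j => (z j).1) i else (z i).2) ≤
          ∑ z : Fin M → X × Y, (∏ i, P i (z i)) * F (fun i => (z i).1) (fun i => (z i).2) := by
  classical
  let I := {i : Fin M // (i : ℕ) < m}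
  let J := {i : Fin M // ¬(i : ℕ) < m}
  -- the mean of `F` over the coordinates from `m` on, the past being `x` and `y`
  let T : (I → X) → (I → Y) → ℝ := fun x y => ∑ v : J → X × Y, (∏ j : J, P j (v j)) *
    F (fun i => if h : (i : ℕ) < m then x ⟨i, h⟩ else (v ⟨i, h⟩).1)
      (fun i => if h : (i : ℕ) < m then y ⟨i, h⟩ else (v ⟨i, h⟩).2)
  have hT0 : ∀ x y, 0 ≤ T x y := fun x y =>
    sum_nonneg fun v _ => mul_nonneg (prod_nonneg fun j _ => hP _ _) (hF _ _)
  choose φ hφ using fun x : I → X => Finite.exists_min (T x)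
  let y0 : Y := Classical.arbitrary Y
  refine ⟨fun x i => if h : (i : ℕ) < m then φ (fun j => x j) ⟨i, h⟩ else y0, ?_, ?_⟩
  · intro x x' hx
    have : (fun j : I => x j) = fun j : I => x' j := funext fun j => hx j j.2
    simp only [this]
  · intro S hS hS1 hS2
    have split : ∀ (W : Fin M → X × Y → ℝ) (u : I → X × Y) (v : J → X × Y),
        ∏ i : Fin M, W i (if h : (i : ℕ) < m then u ⟨i, h⟩ else v ⟨i, h⟩) =
          (∏ i : I, W i (u i)) * ∏ j : J, W j (v j) := fun W u v => by
      rw [← Fintype.prod_subtype_mul_prod_subtype (fun i : Fin M => (i : ℕ) < m)]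
      congr 1
      · exact prod_congr rfl fun i _ => by rw [dif_pos i.2]
      · exact prod_congr rfl fun i _ => by rw [dif_neg i.2]
    have hR : ∑ z : Fin M → X × Y, (∏ i, P i (z i)) * F (fun i => (z i).1) (fun i => (z i).2) =
        ∑ x : I → X, ∑ y : I → Y, (∏ i : I, P i (x i, y i)) * T x y := by
      rw [sum_pi_eq_sum_sum_subtype m, sum_pi_prod_eq_sum_sum]
      refine sum_congr rfl fun x _ => sum_congr rfl fun y _ => ?_
      rw [mul_sum]
      refine sum_congr rfl fun v _ => ?_
      beta_reduce
      rw [split P (fun i => (x i, y i)) v, mul_assoc]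
      congr 3 <;> ext i <;> split_ifs <;> rfl
    rw [hR, sum_pi_eq_sum_sum_subtype m, sum_pi_prod_eq_sum_sum]
    refine sum_le_sum fun x _ => ?_
    calc _ ≤ ∑ y : I → Y, (∏ i : I, S i (x i, y i)) * T x (φ x) := by
          refine sum_le_sum fun y _ => ?_
          rw [mul_sum]
          refine sum_le_sum fun v _ => ?_
          beta_reduce
          rw [split S (fun i => (x i, y i)) v, mul_assoc]
          refine mul_le_mul_of_nonneg_left ?_ (prod_nonneg fun i _ => hS _ _)
          refine mul_le_mul (prod_le_prod (fun i _ => hS _ _)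
            fun j _ => hS2 _ (not_lt.1 j.2) _) (le_of_eq ?_) (hF _ _)
            (prod_nonneg fun i _ => hP _ _)
          have h1 : (fun i : Fin M => (if h : (i : ℕ) < m then (x ⟨i, h⟩, y ⟨i, h⟩)
              else v ⟨i, h⟩).1) =
              fun i : Fin M => if h : (i : ℕ) < m then x ⟨i, h⟩ else (v ⟨i, h⟩).1 := by
            ext i; split_ifs <;> rfl
          have h2 : (fun j : I => (if h : ((j : Fin M) : ℕ) < m then (x ⟨j, h⟩, y ⟨j, h⟩)
              else v ⟨j, h⟩).1) = x := by
            ext j; rw [dif_pos j.2]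
          rw [h1]
          congr 1
          ext i
          by_cases h : (i : ℕ) < m
          · simp only [if_pos h, dif_pos h]
            exact congrFun (congrArg φ h2) _
          · simp only [if_neg h, dif_neg h]
      _ = (∏ i : I, ∑ y, S i (x i, y)) * T x (φ x) := by
          rw [← sum_mul, Fintype.prod_sum]
      _ ≤ (∏ i : I, ∑ y, P i (x i, y)) * T x (φ x) := by
          refine mul_le_mul_of_nonneg_right ?_ (hT0 _ _)
          exact prod_le_prod (fun i _ => sum_nonneg fun y _ => hS _ _) fun i _ => hS1 _ i.2 _
      _ = ∑ y : I → Y, (∏ i : I, P i (x i, y i)) * T x (φ x) := by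
          rw [← sum_mul, Fintype.prod_sum]
      _ ≤ _ := sum_le_sum fun y _ =>
          mul_le_mul_of_nonneg_left (hφ x y) (prod_nonneg fun i _ => hP _ _)

/-! ### The number of transmitted bits -/

theorem sum_newBits {R : ℝ} (hR : 0 ≤ R) (n : ℕ) :
    ∑ k : Fin n, newBits R k = ⌊(n : ℝ) * R⌋₊ := by
  rw [← Finset.sum_range (fun k => newBits R k)]
  induction n with
  | zero => simp
  | succ n ih =>
    rw [sum_range_succ, ih, newBits]
    have : ⌊(n : ℝ) * R⌋₊ ≤ ⌊((n : ℝ) + 1) * R⌋₊ := Nat.floor_le_floor (by nlinarith)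
    push_cast
    omega

theorem card_bits_le {R : ℝ} (hR : 0 ≤ R) (n : ℕ) :
    (Fintype.card (Bits R n) : ℝ) ≤ (2 : ℝ) ^ ((n : ℝ) * R) := by
  have h : Fintype.card (Bits R n) = 2 ^ ⌊(n : ℝ) * R⌋₊ := by
    rw [← sum_newBits hR, ← prod_pow_eq_pow_sum]
    simp [Bits]
  rw [h]
  push_cast
  rw [← Real.rpow_natCast]
  exact Real.rpow_le_rpow_of_exponent_le one_le_two (Nat.floor_le (by positivity))

/-! ### The error of a single symbol under the tilted law -/

/-- The tilting cost of the decoder of symbol `k + 1`: the symbols before the cut `min k (n - Δ)`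
cost a factor `a` each, the later ones among the first `n` that this decoder sees cost `b` each. -/
theorem prod_ite_le_pow_mul_pow {a b : ℝ} (ha : 1 ≤ a) (hb : 1 ≤ b) (n Δ k : ℕ) :
    (∏ i : Fin (k + 1 + Δ),
        if (i : ℕ) < min k (n - Δ) then a else if (i : ℕ) < n then b else 1) ≤
      a ^ (n - Δ) * b ^ min n (Δ + 1) := by
  rw [← Finset.prod_range
    (fun i => if i < min k (n - Δ) then a else if i < n then b else (1 : ℝ))]
  have h : ∀ i, (if i < min k (n - Δ) then a else if i < n then b else (1 : ℝ)) =
      (if i < min k (n - Δ) then a else 1) *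
        (if min k (n - Δ) ≤ i ∧ i < n then b else 1) := fun i => by
    by_cases h1 : i < min k (n - Δ)
    · rw [if_pos h1, if_pos h1, if_neg (by omega), mul_one]
    · by_cases h2 : i < n
      · rw [if_neg h1, if_neg h1, if_pos h2, if_pos ⟨not_lt.1 h1, h2⟩, one_mul]
      · rw [if_neg h1, if_neg h1, if_neg h2, if_neg (by tauto), one_mul]
  simp only [h]
  rw [prod_mul_distrib, ← prod_filter, ← prod_filter, prod_const, prod_const]
  refine mul_le_mul (pow_le_pow_right₀ ha ?_) (pow_le_pow_right₀ hb ?_) (by positivity)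
    (by positivity)
  · calc _ ≤ #(range (n - Δ)) := card_le_card fun i hi => by
          simp only [mem_filter, mem_range] at hi ⊢; omega
      _ = _ := card_range _
  · calc _ ≤ #(Ico (min k (n - Δ)) (min n (k + 1 + Δ))) := card_le_card fun i hi => by
          simp only [mem_filter, mem_range, mem_Ico] at hi ⊢; omega
      _ ≤ _ := by rw [Nat.card_Ico]; omega

theorem prod_ite_lt_le_pow {ρ : ℝ} (h0 : 0 ≤ ρ) (h1 : ρ ≤ 1) {n N j : ℕ} (hj : j ≤ min n N) :
    (∏ i : Fin N, if (i : ℕ) < n then ρ else 1) ≤ ρ ^ j := by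
  rw [← Finset.prod_range (fun i => if i < n then ρ else (1 : ℝ)), ← prod_filter, prod_const]
  refine pow_le_pow_of_le_one h0 h1 ?_
  calc j = #(range j) := (card_range j).symm
    _ ≤ _ := card_le_card fun i hi => by simp only [mem_filter, mem_range] at hi ⊢; omega

open Classical in
/-- The indicator that the decoder `d` misses symbol `k + 1` when the source symbols are `x` and
the side-information is `y`. -/
noncomputable def missed {X Y : Type*} {R : ℝ} {Δ : ℕ} (e : Encoder X R) (d : Decoder X Y R Δ)
    (k : ℕ) (x : Fin (k + 1 + Δ) → X) (y : Fin (k + 1 + Δ) → Y) : ℝ :=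
  if d k (e.sent (k + 1 + Δ) x) y ≠ x ⟨k, by omega⟩ then 1 else 0

section Missed

variable {X Y : Type*} {R : ℝ} {Δ : ℕ} (e : Encoder X R) (d : Decoder X Y R Δ) (k : ℕ)
  (x : Fin (k + 1 + Δ) → X) (y : Fin (k + 1 + Δ) → Y)

theorem missed_nonneg : 0 ≤ missed e d k x y := by
  unfold missed; split_ifs <;> norm_num

theorem missed_le_one : missed e d k x y ≤ 1 := by
  unfold missed; split_ifs <;> norm_num

theorem one_le_missed (h : missed e d k x y ≠ 0) : 1 ≤ missed e d k x y := by
  unfold missed at h ⊢; split_ifs at h ⊢ <;> simp_all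

theorem eq_of_missed_eq_zero (h : missed e d k x y = 0) :
    d k (e.sent (k + 1 + Δ) x) y = x ⟨k, by omega⟩ := by
  unfold missed at h; split_ifs at h with h1
  · norm_num at h
  · simpa using h1

theorem errorProb_eq_sum_missed [Fintype X] [Fintype Y] (p : X × Y → ℝ) :
    errorProb p e d k = ∑ z : Fin (k + 1 + Δ) → X × Y,
      (∏ i, p (z i)) * missed e d k (fun i => (z i).1) (fun i => (z i).2) := by
  unfold errorProb missed
  refine sum_congr rfl fun z _ => ?_
  split_ifs <;> simp

end Missed

/-- The law that is `q` on the first `n` coordinates and `p` on the later ones. -/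
def switchLaw {A : Type*} (n : ℕ) (q p : A → ℝ) (i : ℕ) : A → ℝ := if i < n then q else p

theorem switchLaw_nonneg {A : Type*} {q p : A → ℝ} (hq : ∀ a, 0 ≤ q a) (hp : ∀ a, 0 ≤ p a)
    (n i : ℕ) (a : A) : 0 ≤ switchLaw n q p i a := by
  unfold switchLaw; split_ifs; exacts [hq a, hp a]

theorem sum_switchLaw {A : Type*} [Fintype A] {q p : A → ℝ} (hq : ∑ a, q a = 1)
    (hp : ∑ a, p a = 1) (n i : ℕ) : ∑ a, switchLaw n q p i a = 1 := by
  unfold switchLaw; split_ifs; exacts [hq, hp]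

/-- The error probability of symbol `k + 1` under the law that is `q` up to time `n`, for a decoder
that is told the symbols before the cut `min k (n - Δ)`, compared with its error probability under
the true law `p`. Before the cut only the `X`-marginals have to be tilted, because there the decoder
uses the substitute `ψ` for the side-information. -/
theorem exists_sideInfo_error_le {X Y : Type*} [Fintype X] [Fintype Y] [Nonempty Y]
    {p q : X × Y → ℝ} (hp : p ∈ stdSimplex ℝ (X × Y)) (hq : q ∈ stdSimplex ℝ (X × Y))
    {l₁ l₂ : X × Y → ℝ} {a b ρ s : ℝ} (ha : 1 ≤ a) (hb : 1 ≤ b) (hρ0 : 0 ≤ ρ) (hρ1 : ρ ≤ 1)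
    (hs : 0 ≤ s)
    (h₁ : ∀ x, ∑ y, q (x, y) * Real.exp (-l₁ (x, y)) ≤ a * ∑ y, p (x, y))
    (h₂ : ∀ z, q z * Real.exp (-l₂ z) ≤ b * p z)
    (hρ₁ : ∑ z, q z * Real.exp (s * l₁ z) ≤ ρ) (hρ₂ : ∑ z, q z * Real.exp (s * l₂ z) ≤ ρ)
    {R : ℝ} {Δ : ℕ} (e : Encoder X R) (d : Decoder X Y R Δ) (n k : ℕ) :
    ∃ ψ : (Fin (k + 1 + Δ) → X) → Fin (k + 1 + Δ) → Y,
      (∀ x x' : Fin (k + 1 + Δ) → X,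
        (∀ i : Fin (k + 1 + Δ), (i : ℕ) < min k (n - Δ) → x i = x' i) → ψ x = ψ x') ∧
      ∑ z : Fin (k + 1 + Δ) → X × Y, (∏ i : Fin (k + 1 + Δ), switchLaw n q p i (z i)) *
          missed e d k (fun i => (z i).1)
            (fun i => if (i : ℕ) < min k (n - Δ) then ψ (fun j => (z j).1) i else (z i).2) ≤
        a ^ (n - Δ) * b ^ min n (Δ + 1) * errorProb p e d k + ρ ^ min n Δ := by
  classical
  have hpq := switchLaw_nonneg hq.1 hp.1 n
  -- the factor by which the tilted weights may exceed `p`, and the tilt itself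
  let c : ℕ → ℝ := fun i => if i < min k (n - Δ) then a else if i < n then b else 1
  let l : ℕ → X × Y → ℝ :=
    fun i z => if i < min k (n - Δ) then l₁ z else if i < n then l₂ z else 0
  have hc0 : ∀ i, 0 ≤ c i := fun i => by
    simp only [c]; split_ifs <;> linarith
  obtain ⟨ψ, hψ, hS⟩ := exists_past_sideInfo (M := k + 1 + Δ) (min k (n - Δ))
    (P := fun i z => c i * p z) (fun i z => mul_nonneg (hc0 _) (hp.1 _))
    (F := missed e d k) (missed_nonneg e d k)
  refine ⟨ψ, hψ, ?_⟩
  refine (sum_prod_mul_le_tilt (w := fun i : Fin (k + 1 + Δ) => switchLaw n q p i)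
    (l := fun i => l i) (fun i z => hpq i z) hs (fun z => missed_nonneg e d k _ _)
    (fun z => missed_le_one e d k _ _)).trans ?_
  refine add_le_add ((hS (fun i z => switchLaw n q p i z * Real.exp (-l i z)) ?_ ?_ ?_).trans ?_) ?_
  · exact fun i z => mul_nonneg (hpq i z) (Real.exp_pos _).le
  · intro i hi x
    have hn : (i : ℕ) < n := by omega
    simp only [l, c, switchLaw, if_pos hi, if_pos hn]
    rw [← mul_sum]
    exact h₁ x
  · intro i hi z
    have hi' : ¬(i : ℕ) < min k (n - Δ) := not_lt.2 hi
    by_cases hn : (i : ℕ) < n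
    · simp only [l, c, switchLaw, if_neg hi', if_pos hn]
      exact h₂ z
    · simp only [l, c, switchLaw, if_neg hi', if_neg hn, neg_zero, Real.exp_zero, mul_one,
        one_mul, le_refl]
  · have h : ∀ z : Fin (k + 1 + Δ) → X × Y, (∏ i : Fin (k + 1 + Δ), c i * p (z i)) =
        (∏ i : Fin (k + 1 + Δ), c i) * ∏ i, p (z i) := fun z => prod_mul_distrib
    simp only [h, mul_assoc]
    rw [← mul_sum, ← errorProb_eq_sum_missed, ← mul_assoc]
    refine mul_le_mul_of_nonneg_right (prod_ite_le_pow_mul_pow ha hb n Δ k) ?_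
    rw [errorProb_eq_sum_missed]
    exact sum_nonneg fun z _ => mul_nonneg (prod_nonneg fun i _ => hp.1 _)
      (missed_nonneg e d k _ _)
  · refine le_trans ?_ (prod_ite_lt_le_pow (N := k + 1 + Δ) hρ0 hρ1 (n := n) (by omega))
    refine prod_le_prod (fun i _ => sum_nonneg fun z _ =>
      mul_nonneg (hpq i z) (Real.exp_pos _).le) fun i _ => ?_
    by_cases hn : (i : ℕ) < n
    · by_cases hi : (i : ℕ) < min k (n - Δ)
      · simpa only [l, switchLaw, if_pos hi, if_pos hn] using hρ₁
      · simpa only [l, switchLaw, if_neg hi, if_pos hn] using hρ₂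
    · have hi : ¬(i : ℕ) < min k (n - Δ) := by omega
      simp only [l, switchLaw, if_neg hi, if_neg hn, mul_zero, Real.exp_zero, mul_one]
      exact hp.2.le

/-! ### The converse at a finite delay -/

theorem sent_castLE {X : Type*} {R : ℝ} (e : Encoder X R) {M N : ℕ} (h : M ≤ N)
    {x x' : Fin N → X} (hx : e.sent N x = e.sent N x') :
    e.sent M (fun i => x (Fin.castLE h i)) = e.sent M fun i => x' (Fin.castLE h i) := by
  funext j
  exact congrFun hx (Fin.castLE h j)

/-- Feedforward decoding: if each of the first `n` symbols is recovered from the bits, the earlier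
symbols and the side-information, then the bits, the side-information and the symbols after time `n`
determine the whole source sequence. -/
theorem eq_of_sent_eq {X Y : Type*} {R : ℝ} {Δ : ℕ} (e : Encoder X R) (d : Decoder X Y R Δ)
    {n : ℕ} {ψ : (k : ℕ) → (Fin (k + 1 + Δ) → X) → Fin (k + 1 + Δ) → Y} {m : ℕ → ℕ}
    (hm : ∀ k, m k ≤ k)
    (hψ : ∀ k, ∀ x x' : Fin (k + 1 + Δ) → X,
      (∀ i : Fin (k + 1 + Δ), (i : ℕ) < m k → x i = x' i) → ψ k x = ψ k x')
    {z z' : Fin (n + Δ) → X × Y} (hy : ∀ i, (z i).2 = (z' i).2)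
    (hx : ∀ i : Fin (n + Δ), n ≤ (i : ℕ) → (z i).1 = (z' i).1)
    (hs : e.sent (n + Δ) (fun i => (z i).1) = e.sent (n + Δ) fun i => (z' i).1)
    (hz : ∀ k : Fin n, missed e d k (fun i => (z (Fin.castLE (by omega) i)).1)
      (fun i => if (i : ℕ) < m k then ψ k (fun j => (z (Fin.castLE (by omega) j)).1) i
        else (z (Fin.castLE (by omega) i)).2) = 0)
    (hz' : ∀ k : Fin n, missed e d k (fun i => (z' (Fin.castLE (by omega) i)).1)
      (fun i => if (i : ℕ) < m k then ψ k (fun j => (z' (Fin.castLE (by omega) j)).1) i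
        else (z' (Fin.castLE (by omega) i)).2) = 0) :
    z = z' := by
  have key : ∀ j : ℕ, ∀ hj : j < n + Δ, (z ⟨j, hj⟩).1 = (z' ⟨j, hj⟩).1 := by
    intro j
    induction j using Nat.strong_induction_on with
    | _ j ih =>
      intro hj
      by_cases hjn : j < n
      · have h1 := eq_of_missed_eq_zero e d _ _ _ (hz ⟨j, hjn⟩)
        have h2 := eq_of_missed_eq_zero e d _ _ _ (hz' ⟨j, hjn⟩)
        have h3 := sent_castLE e (M := j + 1 + Δ) (by omega) hs
        have h4 := hψ j (fun i => (z (Fin.castLE (by omega) i)).1)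
          (fun i => (z' (Fin.castLE (by omega) i)).1)
          fun i hi => ih i (lt_of_lt_of_le hi (hm j)) _
        simp only [h3, h4, hy] at h1
        exact h1.symm.trans h2
      · exact hx _ (not_lt.1 hjn)
  funext i
  exact Prod.ext (key i i.2) (hy i)

/-- The finite-delay converse. Under the law that is `q` on the first `n` symbols, either some
decoder errs, or the symbols are recovered from too few bits. -/
theorem one_le_of_tilt {X Y : Type*} [Fintype X] [Fintype Y]
    {p q : X × Y → ℝ} (hp : p ∈ stdSimplex ℝ (X × Y)) (hq : q ∈ stdSimplex ℝ (X × Y))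
    {l₁ l₂ l₃ : X × Y → ℝ} {a b θ ρ s : ℝ} (ha : 1 ≤ a) (hb : 1 ≤ b) (hθ : 0 ≤ θ) (hρ0 : 0 ≤ ρ)
    (hρ1 : ρ ≤ 1) (hs : 0 ≤ s)
    (h₁ : ∀ x, ∑ y, q (x, y) * Real.exp (-l₁ (x, y)) ≤ a * ∑ y, p (x, y))
    (h₂ : ∀ z, q z * Real.exp (-l₂ z) ≤ b * p z)
    (h₃ : ∀ z, q z * Real.exp (-l₃ z) ≤ θ * marginalY q z.2)
    (hρ₁ : ∑ z, q z * Real.exp (s * l₁ z) ≤ ρ) (hρ₂ : ∑ z, q z * Real.exp (s * l₂ z) ≤ ρ)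
    (hρ₃ : ∑ z, q z * Real.exp (s * l₃ z) ≤ ρ)
    {R : ℝ} {Δ : ℕ} (e : Encoder X R) (d : Decoder X Y R Δ) (n : ℕ) :
    1 ≤ Fintype.card (Bits R (n + Δ)) * θ ^ n + ρ ^ n +
      ∑ k : Fin n,
        (a ^ (n - Δ) * b ^ min n (Δ + 1) * errorProb p e d k + ρ ^ min n Δ) := by
  classical
  have hne : Nonempty (X × Y) := by
    by_contra h
    rw [not_nonempty_iff] at h
    simpa using hp.2
  have : Nonempty Y := hne.map Prod.snd
  choose ψ hψ hψE using
    exists_sideInfo_error_le hp hq ha hb hρ0 hρ1 hs h₁ h₂ hρ₁ hρ₂ e d n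
  have hpq := switchLaw_nonneg hq.1 hp.1 n
  have hpq1 := sum_switchLaw hq.2 hp.2 n
  let G : (k : ℕ) → (Fin (k + 1 + Δ) → X × Y) → ℝ := fun k z =>
    missed e d k (fun i => (z i).1)
      (fun i => if (i : ℕ) < min k (n - Δ) then ψ k (fun j => (z j).1) i else (z i).2)
  have hle : ∀ k : Fin n, (k : ℕ) + 1 + Δ ≤ n + Δ := fun k => by omega
  let C : Finset (Fin (n + Δ) → X × Y) :=
    univ.filter fun z => ∀ k : Fin n, G k (fun i => z (Fin.castLE (hle k) i)) = 0
  let ind : (Fin (n + Δ) → X × Y) → ℝ := fun z => if z ∈ C then 1 else 0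
  have hind : ∀ z, 1 ≤ ind z + ∑ k : Fin n, G k (fun i => z (Fin.castLE (hle k) i)) := by
    intro z
    have h0 : ∀ k ∈ (univ : Finset (Fin n)), 0 ≤ G k (fun i => z (Fin.castLE (hle k) i)) :=
      fun k _ => missed_nonneg e d k _ _
    by_cases hz : z ∈ C
    · simp only [ind, if_pos hz]
      linarith [sum_nonneg h0]
    · simp only [C, mem_filter, mem_univ, true_and, not_forall] at hz
      obtain ⟨k, hk⟩ := hz
      have h1 : 1 ≤ G k (fun i => z (Fin.castLE (hle k) i)) := one_le_missed e d k _ _ hk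
      have h2 := single_le_sum h0 (mem_univ k)
      have h3 : 0 ≤ ind z := by simp only [ind]; split_ifs <;> norm_num
      linarith
  have htotal : ∑ z : Fin (n + Δ) → X × Y, ∏ i : Fin (n + Δ), switchLaw n q p i (z i) = 1 := by
    rw [← Fintype.prod_sum (fun (i : Fin (n + Δ)) z => switchLaw n q p i z)]
    simp [hpq1]
  have hsplit : 1 ≤
      ∑ z : Fin (n + Δ) → X × Y, (∏ i : Fin (n + Δ), switchLaw n q p i (z i)) * ind z +
      ∑ k : Fin n, ∑ z : Fin (n + Δ) → X × Y, (∏ i : Fin (n + Δ), switchLaw n q p i (z i)) *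
        G k (fun i => z (Fin.castLE (hle k) i)) := by
    rw [sum_comm, ← sum_add_distrib, ← htotal]
    refine sum_le_sum fun z _ => ?_
    rw [← mul_sum, ← mul_add]
    exact le_mul_of_one_le_right (prod_nonneg fun i _ => hpq i _) (hind z)
  refine hsplit.trans (add_le_add ?_ (sum_le_sum fun k _ => ?_))
  · let l : ℕ → X × Y → ℝ := fun i z => if i < n then l₃ z else 0
    refine (sum_prod_mul_le_tilt (w := fun i : Fin (n + Δ) => switchLaw n q p i)
      (l := fun i => l i) (fun i z => hpq i z) hs (F := ind)
      (fun z => by simp only [ind]; split_ifs <;> norm_num)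
      (fun z => by simp only [ind]; split_ifs <;> norm_num)).trans (add_le_add ?_ ?_)
    · -- Beyond time `n` the source symbols are counted as side-information.
      let π : ℕ → X × Y → Y × Option X := fun i z => (z.2, if i < n then none else some z.1)
      let V : ℕ → Y × Option X → ℝ := fun i t =>
        if i < n then t.2.elim (θ * marginalY q t.1) fun _ => 0
        else t.2.elim 0 fun x => p (x, t.1)
      have hmY : ∀ y, 0 ≤ marginalY q y := fun y => sum_nonneg fun x _ => hq.1 _
      have hV : ∀ i : Fin (n + Δ), ∑ t, V i t = if (i : ℕ) < n then θ else 1 := by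
        intro i
        by_cases hi : (i : ℕ) < n
        · simp only [V, if_pos hi, Fintype.sum_prod_type, Fintype.sum_option, Option.elim_none,
            Option.elim_some, sum_const_zero, add_zero]
          rw [← mul_sum]
          have : ∑ y, marginalY q y = 1 := by
            rw [← hq.2, Fintype.sum_prod_type_right]; rfl
          rw [this, mul_one]
        · simp only [V, if_neg hi, Fintype.sum_prod_type, Fintype.sum_option, Option.elim_none,
            Option.elim_some, zero_add]
          rw [← hp.2, Fintype.sum_prod_type_right]
      have hbound := sum_prod_le_card_mul (C := C)
        (β := fun z => e.sent (n + Δ) fun i => (z i).1)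
        (π := fun i : Fin (n + Δ) => π i)
        (v := fun (i : Fin (n + Δ)) z => switchLaw n q p i z * Real.exp (-l i z))
        (V := fun i => V i) ?_ (fun i z => mul_nonneg (hpq i z) (Real.exp_pos _).le) ?_ ?_
      · have hprod : (∏ i : Fin (n + Δ), if (i : ℕ) < n then θ else 1) = θ ^ n := by
          simp [Fin.prod_univ_add]
        simp only [hV, hprod] at hbound
        refine le_trans (le_of_eq ?_) hbound
        simp only [ind, mul_ite, mul_one, mul_zero]
        rw [← sum_filter]
        congr 1
        ext z
        simp
      · intro z hz z' hz' h
        simp only [Prod.mk.injEq] at h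
        have hy : ∀ i, (z i).2 = (z' i).2 := fun i => congrArg Prod.fst (congrFun h.2 i)
        refine eq_of_sent_eq e d (fun k => min_le_left k (n - Δ)) hψ hy (fun i hi => ?_) h.1
          (mem_filter.1 hz).2 (mem_filter.1 hz').2
        have := congrArg Prod.snd (congrFun h.2 i)
        simpa [π, not_lt.2 hi] using this
      · intro i t
        simp only [V]
        split_ifs
        · cases t.2 with
          | none => exact mul_nonneg hθ (hmY _)
          | some x => exact le_rfl
        · cases t.2 with
          | none => exact le_rfl
          | some x => exact hp.1 _
      · intro i z
        by_cases hi : (i : ℕ) < n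
        · simpa [V, π, l, switchLaw, hi] using h₃ z
        · simp [V, π, l, switchLaw, hi]
    · refine le_trans ?_ (prod_ite_lt_le_pow (N := n + Δ) hρ0 hρ1 (n := n) (by omega))
      refine prod_le_prod (fun i _ => sum_nonneg fun z _ =>
        mul_nonneg (hpq i z) (Real.exp_pos _).le) fun i _ => ?_
      by_cases hi : (i : ℕ) < n
      · simpa only [l, switchLaw, if_pos hi] using hρ₃
      · simp only [l, switchLaw, if_neg hi, mul_zero, Real.exp_zero, mul_one]
        exact hp.2.le
  · rw [sum_prod_mul_castLE hpq1 (hle k)]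
    exact hψE k

/-! ### Tilts built from log-likelihood ratios -/

theorem marginalX_eq_zero {X Y : Type*} [Fintype Y] {p q : X × Y → ℝ} (hp : ∀ z, 0 ≤ p z)
    (hac : ∀ z, p z = 0 → q z = 0) (x : X) (hx : marginalX p x = 0) : marginalX q x = 0 := by
  have h := (sum_eq_zero_iff_of_nonneg fun y _ => hp (x, y)).1 hx
  exact sum_eq_zero fun y hy => hac _ (h y hy)

/-- The tilt by a log-likelihood ratio less `c` bits turns `t` into `2 ^ c * u`, except that it
leaves `0` at `t = 0`. -/
theorem mul_exp_neg_log_div_sub_le {t u : ℝ} (ht : 0 ≤ t) (hu : 0 ≤ u) (hut : u = 0 → t = 0)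
    (c : ℝ) : t * Real.exp (-(Real.log (t / u) - c * Real.log 2)) ≤ (2 : ℝ) ^ c * u := by
  rcases ht.eq_or_lt with rfl | ht
  · rw [zero_mul]; positivity
  · have hu' : 0 < u := hu.lt_of_ne fun h => ht.ne' (hut h.symm)
    rw [neg_sub, Real.exp_sub, Real.exp_log (div_pos ht hu'), Real.rpow_def_of_pos two_pos,
      mul_comm (Real.log 2)]
    apply le_of_eq
    field_simp

theorem sum_exp_neg_marginalX_le {X Y : Type*} [Fintype Y] {p q : X × Y → ℝ}
    (hp : ∀ z, 0 ≤ p z) (hq : ∀ z, 0 ≤ q z) (hac : ∀ z, p z = 0 → q z = 0) (c : ℝ) (x : X) :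
    ∑ y, q (x, y) * Real.exp (-(Real.log (marginalX q x / marginalX p x) - c * Real.log 2)) ≤
      (2 : ℝ) ^ c * ∑ y, p (x, y) := by
  rw [← sum_mul]
  exact mul_exp_neg_log_div_sub_le (sum_nonneg fun y _ => hq _) (sum_nonneg fun y _ => hp _)
    (marginalX_eq_zero hp hac x) c

theorem sum_mul_log_sub_neg {A : Type*} [Fintype A] {w r : A → ℝ} (hw : ∑ a, w a = 1) {c : ℝ}
    (h : ∑ a, w a * Real.logb 2 (r a) < c) :
    ∑ a, w a * (Real.log (r a) - c * Real.log 2) < 0 := by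
  have h2 : 0 < Real.log 2 := Real.log_pos one_lt_two
  have : ∑ a, w a * (Real.log (r a) - c * Real.log 2) =
      (∑ a, w a * Real.logb 2 (r a) - c) * Real.log 2 := by
    have h3 : ∀ a, Real.log (r a) = Real.logb 2 (r a) * Real.log 2 := fun a => by
      rw [Real.logb, div_mul_cancel₀ _ h2.ne']
    simp only [h3, mul_sub, sum_sub_distrib, ← sum_mul, hw, sub_mul, one_mul, ← mul_assoc]
  rw [this]
  exact mul_neg_of_neg_of_pos (by linarith) h2

/-- Tilts by log-likelihood ratios, with slack `ε` in each exponent, satisfy the hypotheses of the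
finite-delay converse for one common small argument `s`. -/
theorem exists_tilt {X Y : Type*} [Fintype X] [Fintype Y] {p q : X × Y → ℝ}
    (hq : q ∈ stdSimplex ℝ (X × Y)) {a b h : ℝ}
    (ha : ∑ x, marginalX q x * Real.logb 2 (marginalX q x / marginalX p x) < a)
    (hb : ∑ z, q z * Real.logb 2 (q z / p z) < b) (hh : h < condEntropy q) :
    ∃ s ρ : ℝ, 0 ≤ s ∧ 0 ≤ ρ ∧ ρ < 1 ∧
      ∑ z, q z * Real.exp (s * (Real.log (marginalX q z.1 / marginalX p z.1) -
        a * Real.log 2)) ≤ ρ ∧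
      ∑ z, q z * Real.exp (s * (Real.log (q z / p z) - b * Real.log 2)) ≤ ρ ∧
      ∑ z, q z * Real.exp (s * (Real.log (q z / marginalY q z.2) - -h * Real.log 2)) ≤ ρ := by
  have e1 := eventually_sum_mul_exp_lt_one hq.2 (sum_mul_log_sub_neg (c := a)
    (r := fun z : X × Y => marginalX q z.1 / marginalX p z.1) hq.2
    (by
      rw [Fintype.sum_prod_type]
      exact lt_of_eq_of_lt (sum_congr rfl fun x _ => (sum_mul univ (fun y => q (x, y))
        (Real.logb 2 (marginalX q x / marginalX p x))).symm) ha))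
  have e2 := eventually_sum_mul_exp_lt_one hq.2 (sum_mul_log_sub_neg (c := b)
    (r := fun z : X × Y => q z / p z) hq.2 hb)
  have e3 := eventually_sum_mul_exp_lt_one hq.2 (sum_mul_log_sub_neg (c := -h)
    (r := fun z : X × Y => q z / marginalY q z.2) hq.2
    (by rw [Fintype.sum_prod_type]; unfold condEntropy at hh; linarith))
  obtain ⟨s, ⟨h1, h2, h3⟩, hs⟩ := ((e1.and (e2.and e3)).and self_mem_nhdsWithin).exists
  refine ⟨s, max (max _ _) _, le_of_lt hs, ?_, max_lt (max_lt h1 h2) h3,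
    le_max_of_le_left (le_max_left _ _), le_max_of_le_left (le_max_right _ _), le_max_right _ _⟩
  exact le_max_of_le_right (sum_nonneg fun z _ => mul_nonneg (hq.1 _) (Real.exp_pos _).le)

/-! ### Letting the delay tend to infinity -/

/-- A reliability is bounded by the tilting cost per unit of delay, when the first `⌈Δ / α⌉` symbols
are tilted. Here `c₁` and `c₂` bound the proportions, relative to the delay, of the symbols of which
the `X`-marginal and the joint law are tilted. -/
theorem Achieves.le_of_tilt {X Y : Type*} [Fintype X] [Fintype Y] {p q : X × Y → ℝ}
    (hp : p ∈ stdSimplex ℝ (X × Y)) (hq : q ∈ stdSimplex ℝ (X × Y))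
    (hac : ∀ z, p z = 0 → q z = 0) {R α : ℝ} (hR : 0 < R) (hα : 0 < α)
    (hH : (1 + α) * R < condEntropy q) {a b : ℝ} (ha0 : 0 ≤ a) (hb0 : 0 ≤ b)
    (ha : ∑ x, marginalX q x * Real.logb 2 (marginalX q x / marginalX p x) ≤ a)
    (hb : ∑ z, q z * Real.logb 2 (q z / p z) ≤ b) {c₁ c₂ : ℝ} (hc₁0 : 0 ≤ c₁) (hc₂0 : 0 ≤ c₂)
    (hc₁ : ∀ Δ : ℕ, ((⌈(Δ : ℝ) / α⌉₊ - Δ : ℕ) : ℝ) ≤ c₁ * Δ + 1)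
    (hc₂ : ∀ Δ : ℕ, ((min ⌈(Δ : ℝ) / α⌉₊ (Δ + 1) : ℕ) : ℝ) ≤ c₂ * Δ + 1)
    {e : (Δ : ℕ) → Encoder X R} {d : (Δ : ℕ) → Decoder X Y R Δ} {E : ℝ} (hE : Achieves p e d E) :
    E ≤ c₁ * a + c₂ * b := by
  by_contra! hlt
  obtain ⟨γ, hγ⟩ : ∃ γ, γ = E - (c₁ * a + c₂ * b) := ⟨_, rfl⟩
  have hγ0 : 0 < γ := by linarith
  -- With this slack the exponent still exceeds the tilting cost by `γ / 2`.
  obtain ⟨ε, hε⟩ : ∃ ε, ε = γ / (2 * (c₁ + c₂ + 1)) := ⟨_, rfl⟩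
  have hε0 : 0 < ε := by rw [hε]; positivity
  have hεγ : ε * (c₁ + c₂ + 1) = γ / 2 := by rw [hε]; field_simp
  obtain ⟨h, hRh, hh⟩ := exists_between hH
  obtain ⟨s, ρ, hs, hρ0, hρ1, hρ₁, hρ₂, hρ₃⟩ := exists_tilt (p := p) hq
    (a := a + ε) (b := b + ε) (by linarith) (by linarith) hh
  obtain ⟨K, hK⟩ := hE ε hε0
  let n : ℕ → ℕ := fun Δ => ⌈(Δ : ℝ) / α⌉₊
  let τ : ℝ := (2 : ℝ) ^ (-(h - (1 + α) * R))
  let σ : ℝ := (2 : ℝ) ^ (-(γ / 2))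
  let C : ℝ := (2 : ℝ) ^ (a + b + 2 * ε) * max K 0
  let U : ℕ → ℝ := fun Δ => τ ^ n Δ + ρ ^ n Δ + (α⁻¹ * (C * (Δ * σ ^ Δ)) + C * σ ^ Δ) +
    ((1 + α⁻¹) * ((min (n Δ) Δ : ℕ) * ρ ^ min (n Δ) Δ) + ρ ^ min (n Δ) Δ)
  have hτ0 : 0 ≤ τ := by positivity
  have hσ0 : 0 ≤ σ := by positivity
  have hC0 : 0 ≤ C := by positivity
  have hτ1 : τ < 1 := Real.rpow_lt_one_of_one_lt_of_neg one_lt_two (by linarith)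
  have hσ1 : σ < 1 := Real.rpow_lt_one_of_one_lt_of_neg one_lt_two (by linarith)
  have hn1 : ∀ Δ : ℕ, (Δ : ℝ) / α ≤ n Δ := fun Δ => Nat.le_ceil _
  have hn2 : ∀ Δ : ℕ, (n Δ : ℝ) ≤ α⁻¹ * Δ + 1 := fun Δ => by
    rw [inv_mul_eq_div]
    exact (Nat.ceil_lt_add_one (by positivity)).le
  have hn : Tendsto n atTop atTop := by
    refine tendsto_nat_ceil_atTop.comp ?_
    exact tendsto_natCast_atTop_atTop.atTop_div_const hα
  have hmin : Tendsto (fun Δ => min (n Δ) Δ) atTop atTop :=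
    tendsto_atTop.2 fun m => by
      filter_upwards [hn.eventually_ge_atTop m, eventually_ge_atTop m] with Δ h1 h2
      exact le_min h1 h2
  have hU : Tendsto U atTop (𝓝 0) := by
    have t1 := (tendsto_pow_atTop_nhds_zero_of_lt_one hτ0 hτ1).comp hn
    have t2 := (tendsto_pow_atTop_nhds_zero_of_lt_one hρ0 hρ1).comp hn
    have t3 := ((tendsto_self_mul_const_pow_of_lt_one hσ0 hσ1).const_mul C).const_mul α⁻¹
    have t4 := (tendsto_pow_atTop_nhds_zero_of_lt_one hσ0 hσ1).const_mul C
    have t5 := ((tendsto_self_mul_const_pow_of_lt_one hρ0 hρ1).comp hmin).const_mul (1 + α⁻¹)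
    have t6 := (tendsto_pow_atTop_nhds_zero_of_lt_one hρ0 hρ1).comp hmin
    have := ((t1.add t2).add (t3.add t4)).add (t5.add t6)
    simpa [U, Function.comp_def] using this
  have hU1 : ∀ Δ : ℕ, 0 < Δ → 1 ≤ U Δ := by
    intro Δ hΔ
    have hbase := one_le_of_tilt hp hq (a := (2 : ℝ) ^ (a + ε)) (b := (2 : ℝ) ^ (b + ε))
      (θ := (2 : ℝ) ^ (-h)) (Real.one_le_rpow one_le_two (by linarith))
      (Real.one_le_rpow one_le_two (by linarith)) (by positivity) hρ0 hρ1.le hs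
      (sum_exp_neg_marginalX_le hp.1 hq.1 hac _)
      (fun z => mul_exp_neg_log_div_sub_le (hq.1 z) (hp.1 z) (hac z) _)
      (fun z => mul_exp_neg_log_div_sub_le (hq.1 z) (sum_nonneg fun x _ => hq.1 _)
        (fun h0 => (sum_eq_zero_iff_of_nonneg fun x _ => hq.1 (x, z.2)).1 h0 z.1 (mem_univ _)) _)
      hρ₁ hρ₂ hρ₃ (e Δ) (d Δ) (n Δ)
    have hbits : Fintype.card (Bits R (n Δ + Δ)) * ((2 : ℝ) ^ (-h)) ^ n Δ ≤ τ ^ n Δ := by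
      calc _ ≤ (2 : ℝ) ^ (((n Δ + Δ : ℕ) : ℝ) * R) * ((2 : ℝ) ^ (-h)) ^ n Δ := by
            gcongr; exact card_bits_le hR.le _
        _ = (2 : ℝ) ^ (((n Δ + Δ : ℕ) : ℝ) * R + -h * n Δ) := by
            rw [← Real.rpow_mul_natCast two_pos.le, ← Real.rpow_add two_pos]
        _ ≤ (2 : ℝ) ^ (-(h - (1 + α) * R) * n Δ) := by
            refine Real.rpow_le_rpow_of_exponent_le one_le_two ?_
            have := (div_le_iff₀ hα).1 (hn1 Δ)
            push_cast
            nlinarith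
        _ = τ ^ n Δ := Real.rpow_mul_natCast two_pos.le _ _
    have herr : ∀ k : Fin (n Δ), ((2 : ℝ) ^ (a + ε)) ^ (n Δ - Δ) *
        ((2 : ℝ) ^ (b + ε)) ^ min (n Δ) (Δ + 1) * errorProb p (e Δ) (d Δ) k ≤ C * σ ^ Δ := by
      intro k
      have hk : errorProb p (e Δ) (d Δ) k ≤ max K 0 * (2 : ℝ) ^ (-((Δ : ℝ) * (E - ε))) :=
        (hK k Δ hΔ).trans (by gcongr; exact le_max_left _ _)
      calc _ ≤ ((2 : ℝ) ^ (a + ε)) ^ (n Δ - Δ) * ((2 : ℝ) ^ (b + ε)) ^ min (n Δ) (Δ + 1) *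
            (max K 0 * (2 : ℝ) ^ (-((Δ : ℝ) * (E - ε)))) := by gcongr
        _ = max K 0 * (2 : ℝ) ^ ((a + ε) * (n Δ - Δ : ℕ) + (b + ε) * (min (n Δ) (Δ + 1) : ℕ) +
            -((Δ : ℝ) * (E - ε))) := by
            rw [← Real.rpow_mul_natCast two_pos.le, ← Real.rpow_mul_natCast two_pos.le,
              Real.rpow_add two_pos, Real.rpow_add two_pos]
            ring
        _ ≤ max K 0 * (2 : ℝ) ^ (a + b + 2 * ε + -(γ / 2) * Δ) := by
            refine mul_le_mul_of_nonneg_left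
              (Real.rpow_le_rpow_of_exponent_le one_le_two ?_) (le_max_right _ _)
            have h1 := mul_le_mul_of_nonneg_left (hc₁ Δ) (show 0 ≤ a + ε by linarith)
            have h2 := mul_le_mul_of_nonneg_left (hc₂ Δ) (show 0 ≤ b + ε by linarith)
            have h3 : (a + ε) * (c₁ * Δ + 1) + (b + ε) * (c₂ * Δ + 1) + -((Δ : ℝ) * (E - ε)) =
                a + b + 2 * ε + -(γ / 2) * Δ := by
              rw [show E = γ + (c₁ * a + c₂ * b) by linarith]
              linear_combination (Δ : ℝ) * hεγ
            linarith
        _ = C * σ ^ Δ := by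
            rw [Real.rpow_add two_pos, Real.rpow_mul_natCast two_pos.le]
            simp only [C, σ]
            ring
    have hsum := sum_le_sum fun (k : Fin (n Δ)) (_ : k ∈ univ) =>
      add_le_add_left (herr k) (ρ ^ min (n Δ) Δ)
    have hnmin : (n Δ : ℝ) ≤ (1 + α⁻¹) * (min (n Δ) Δ : ℕ) + 1 := by
      have hα' : 0 < α⁻¹ := inv_pos.2 hα
      rcases le_total (n Δ) Δ with h | h
      · rw [min_eq_left h]
        have : (0 : ℝ) ≤ n Δ := Nat.cast_nonneg _
        nlinarith
      · rw [min_eq_right h]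
        have : (0 : ℝ) ≤ Δ := Nat.cast_nonneg _
        nlinarith [hn2 Δ]
    rw [sum_const, card_univ, Fintype.card_fin, nsmul_eq_mul, mul_add] at hsum
    have hx := mul_le_mul_of_nonneg_right (hn2 Δ) (mul_nonneg hC0 (pow_nonneg hσ0 Δ))
    have hy := mul_le_mul_of_nonneg_right hnmin (pow_nonneg hρ0 (min (n Δ) Δ))
    simp only [U]
    linarith
  have := ge_of_tendsto hU (eventually_atTop.2 ⟨1, fun Δ h => hU1 Δ h⟩)
  linarith

/-! ### The two families of bounds -/

section Bounds

variable {X Y : Type*} [Fintype X] [Fintype Y] {p q : X × Y → ℝ}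

theorem divergence_ne_top {A : Type*} [Fintype A] {q p : A → ℝ} (h : ∀ a, p a = 0 → q a = 0) :
    divergence q p ≠ ⊤ := by
  rw [divergence, if_pos h]
  exact ENNReal.ofReal_ne_top

theorem sum_le_toReal_divergence {A : Type*} [Fintype A] {q p : A → ℝ}
    (h : ∀ a, p a = 0 → q a = 0) :
    ∑ a, q a * Real.logb 2 (q a / p a) ≤ (divergence q p).toReal := by
  rw [divergence, if_pos h, ENNReal.toReal_ofReal']
  exact le_max_left _ _

theorem natCeil_div_le (Δ : ℕ) {α : ℝ} (hα : 0 < α) : (⌈(Δ : ℝ) / α⌉₊ : ℝ) ≤ Δ / α + 1 :=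
  (Nat.ceil_lt_add_one (by positivity)).le

variable {R α : ℝ} {e : (Δ : ℕ) → Encoder X R} {d : (Δ : ℕ) → Decoder X Y R Δ} {E : ℝ}

theorem Achieves.ofReal_le_large (hE : Achieves p e d E) (hp : p ∈ stdSimplex ℝ (X × Y))
    (hR : 0 < R) (hq : q ∈ stdSimplex ℝ (X × Y)) (hα : 1 ≤ α) (hH : (1 + α) * R < condEntropy q) :
    ENNReal.ofReal E ≤ 1 / ENNReal.ofReal α * divergence q p := by
  have hα0 : 0 < α := by linarith
  by_cases hac : ∀ z, p z = 0 → q z = 0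
  · refine ENNReal.ofReal_le_of_le_toReal ?_
    have := hE.le_of_tilt hp hq hac hR hα0 hH ENNReal.toReal_nonneg ENNReal.toReal_nonneg
      (sum_le_toReal_divergence (marginalX_eq_zero hp.1 hac)) (sum_le_toReal_divergence hac)
      (c₁ := 0) (c₂ := 1 / α) le_rfl (by positivity) (fun Δ => ?_) (fun Δ => ?_)
    · rw [ENNReal.toReal_mul, ENNReal.toReal_div, ENNReal.toReal_one,
        ENNReal.toReal_ofReal hα0.le]
      linarith
    · have h : ⌈(Δ : ℝ) / α⌉₊ ≤ Δ := Nat.ceil_le.2 (div_le_self (Nat.cast_nonneg _) hα)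
      rw [Nat.sub_eq_zero_of_le h]
      norm_num
    · refine (Nat.cast_le.2 (min_le_left _ _)).trans ((natCeil_div_le Δ hα0).trans ?_)
      rw [one_div_mul_eq_div]
  · rw [divergence, if_neg hac, ENNReal.mul_top (by simp)]
    exact le_top

theorem Achieves.ofReal_le_small (hE : Achieves p e d E) (hp : p ∈ stdSimplex ℝ (X × Y))
    (hR : 0 < R) (hq : q ∈ stdSimplex ℝ (X × Y)) (hα0 : 0 < α) (hα : α ≤ 1)
    (hH : (1 + α) * R < condEntropy q) :
    ENNReal.ofReal E ≤ ENNReal.ofReal (1 - α) / ENNReal.ofReal α *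
      divergence (marginalX q) (marginalX p) + divergence q p := by
  by_cases hac : ∀ z, p z = 0 → q z = 0
  · have hX := marginalX_eq_zero hp.1 hac
    have hα1 : 0 ≤ 1 - α := by linarith
    refine ENNReal.ofReal_le_of_le_toReal ?_
    have := hE.le_of_tilt hp hq hac hR hα0 hH ENNReal.toReal_nonneg ENNReal.toReal_nonneg
      (sum_le_toReal_divergence hX) (sum_le_toReal_divergence hac)
      (c₁ := (1 - α) / α) (c₂ := 1) (by positivity) zero_le_one (fun Δ => ?_) (fun Δ => ?_)
    · rw [ENNReal.toReal_add _ (divergence_ne_top hac), ENNReal.toReal_mul, ENNReal.toReal_div,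
        ENNReal.toReal_ofReal hα0.le, ENNReal.toReal_ofReal hα1]
      · linarith
      · refine ENNReal.mul_ne_top (ENNReal.div_ne_top ENNReal.ofReal_ne_top ?_)
          (divergence_ne_top hX)
        simpa using hα0
    · rcases le_total ⌈(Δ : ℝ) / α⌉₊ Δ with h | h
      · rw [Nat.sub_eq_zero_of_le h, Nat.cast_zero]
        positivity
      · rw [Nat.cast_sub h]
        have h1 := natCeil_div_le Δ hα0
        have h2 : (1 - α) / α * Δ = Δ / α - Δ := by field_simp
        linarith
    · refine (Nat.cast_le.2 (min_le_right _ _)).trans ?_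
      push_cast
      linarith
  · have : divergence q p = ⊤ := by rw [divergence, if_neg hac]
    rw [this, add_top]
    exact le_top

/-- At `α = 0` the bound is finite only if the `X`-marginals have divergence `0`; then it agrees
with the bound at small positive `α`, for which the entropy condition still holds. -/
theorem Achieves.ofReal_le_small_zero (hE : Achieves p e d E) (hp : p ∈ stdSimplex ℝ (X × Y))
    (hR : 0 < R) (hq : q ∈ stdSimplex ℝ (X × Y)) (hH : R < condEntropy q) :
    ENNReal.ofReal E ≤ ⊤ * divergence (marginalX q) (marginalX p) + divergence q p := by
  by_cases h0 : divergence (marginalX q) (marginalX p) = 0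
  · obtain ⟨r, hr, hrH⟩ := exists_between hH
    have hβ : 0 < min (r / R - 1) 1 := lt_min (by rw [sub_pos, one_lt_div hR]; exact hr) one_pos
    have h := hE.ofReal_le_small hp hR hq hβ (min_le_right _ _) (by
      have h1 : (1 + min (r / R - 1) 1) * R ≤ (1 + (r / R - 1)) * R := by
        gcongr; exact min_le_left _ _
      have h2 : (1 + (r / R - 1)) * R = r := by field_simp; ring
      linarith)
    rw [h0, mul_zero] at h ⊢
    exact h
  · rw [ENNReal.top_mul h0, top_add]
    exact le_top

end Bounds

end DelaySI

theorem theorem3 {X Y : Type*} [Fintype X] [Fintype Y] (p : X × Y → ℝ)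
    (hp : p ∈ stdSimplex ℝ (X × Y)) (R : ℝ) (hR : 0 < R) :
    DelaySI.exponentSI p R ≤ (DelaySI.upperBoundSI p R : EReal) := by
  refine iSup₂_le fun E hE => ?_
  obtain ⟨e, d, h⟩ := hE
  have key : ENNReal.ofReal E ≤ DelaySI.upperBoundSI p R := by
    refine le_min (le_iInf fun q => le_iInf fun α => le_iInf fun hq => le_iInf fun hα =>
      le_iInf fun hH => h.ofReal_le_large hp hR hq hα hH)
      (le_iInf fun q => le_iInf fun α => le_iInf fun hq => le_iInf fun hα0 =>
      le_iInf fun hα1 => le_iInf fun hH => ?_)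
    rcases hα0.eq_or_lt with rfl | hα0
    · simpa using h.ofReal_le_small_zero hp hR hq (by simpa using hH)
    · exact h.ofReal_le_small hp hR hq hα0 hα1 hH
  refine le_trans ?_ (EReal.coe_ennreal_le_coe_ennreal_iff.2 key)
  rw [EReal.coe_ennreal_ofReal]
  exact EReal.coe_le_coe_iff.2 (le_max_left _ _)
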